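/- For integers $a,b$ and a positive integer $c$, let $$S(a,b;c)=\sum_{\substack{x \bmod c\\ \gcd(x,c)=1}} e^{2\pi i\,(ax+b\overline{x})/c},\qquad x\overline{x}\equiv 1 \pmod c,$$ be the classical Kloosterman sum, let $\tau(c)$ be the number of positive divisors of $c$, and let $\phi$ be Euler's totient function. Let $c$ be a squarefree positive integer and let $a,b$ be integers with $\gcd(a,c)=1$. Then $S(a,b;c)\neq 0$. If moreover $c$ is odd, then $$|S(a,b;c)|\;\geq\; \frac{1}{\left(\tau(c)\sqrt{c}\right)^{\phi(c)/\tau(c)-1}}.$$ -/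

import Mathlib

/-- The classical Kloosterman sum `S(a,b;c) = ∑ e((a x + b x̄)/c)`, over the residues `x` modulo `c`
that are coprime to `c`, where `e(t) = exp(2πit)` and `x̄` is the inverse of `x` modulo `c`.
Residues are represented by `0, …, c - 1`; the choice of representatives does not matter. -/
noncomputable def kloostermanSum (a b : ℤ) (c : ℕ) : ℂ :=
  ∑ x ∈ (Finset.range c).filter (fun x => Nat.Coprime x c),
    Complex.exp (2 * (Real.pi : ℂ) * Complex.I *
      (((a : ℂ) * (x : ℂ) + (b : ℂ) * ((((x : ZMod c)⁻¹).val : ℕ) : ℂ)) / (c : ℂ)))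

/-! Nonvanishing: the Chinese remainder theorem reduces to a prime modulus `p`, where a vanishing
sum of `p - 1` values of a character would force `p ∣ p - 1`. Lower bound: take `S(1,m;c)`, to which
a substitution reduces the general case. Its Galois conjugates are the `S(1,k²m;c)`, and their
product is a nonzero rational integer (`one_le_prod_norm_conjugates`). All values `k²m` are attained
equally often, so the product over the orbit of `m` under unit squares already has modulus at least
1. The orbit has at most `φ(c)/τ(c)` points, since 1 has at least `τ(c)` square roots modulo an odd
squarefree `c`. The factors other than `S(1,m;c)` are bounded above on average, by the second moment
over all `t` and AM-GM; no pointwise Weil bound is needed. -/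

theorem AddChar.zmod_eq_pow_val {n : ℕ} [NeZero n] {M : Type*} [Monoid M]
    (ψ : AddChar (ZMod n) M) (x : ZMod n) : ψ x = ψ 1 ^ x.val := by
  rw [← AddChar.map_nsmul_eq_pow]
  simp

/-- For nontrivial `ψ`, vanishing makes the cyclotomic polynomial `Φ_p` divide `∑ X ^ (f i).val`
over `ℤ`; evaluation at 1, where `Φ_p(1) = p`, gives `p ∣ card ι`. -/
theorem sum_addChar_ne_zero_of_prime {p : ℕ} [Fact p.Prime] {ι : Type*} [Fintype ι]
    (ψ : AddChar (ZMod p) ℂ) (f : ι → ZMod p) (h : ¬ p ∣ Fintype.card ι) :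
    ∑ i, ψ (f i) ≠ 0 := by
  intro h0
  by_cases h1 : ψ 1 = 1
  · simp only [AddChar.zmod_eq_pow_val ψ (f _), h1, one_pow, Finset.sum_const, nsmul_eq_mul,
      mul_one, Nat.cast_eq_zero, Finset.card_univ] at h0
    simp [h0] at h
  have hprim : IsPrimitiveRoot (ψ 1) p := by
    have : ψ 1 ^ p = 1 := by
      rw [← AddChar.map_nsmul_eq_pow]
      simp
    exact IsPrimitiveRoot.iff_orderOf.2 (orderOf_eq_prime this h1)
  have hdvd : minpoly ℤ (ψ 1) ∣ ∑ i, Polynomial.X ^ (f i).val := by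
    apply minpoly.isIntegrallyClosed_dvd (hprim.isIntegral (Fact.out : p.Prime).pos)
    simp only [map_sum, map_pow, Polynomial.aeval_X]
    rw [← h0]
    exact Finset.sum_congr rfl fun i _ => (AddChar.zmod_eq_pow_val ψ (f i)).symm
  rw [← Polynomial.cyclotomic_eq_minpoly hprim (Fact.out : p.Prime).pos] at hdvd
  have := Polynomial.eval_dvd (x := (1 : ℤ)) hdvd
  rw [Polynomial.eval_one_cyclotomic_prime, Polynomial.eval_finsetSum] at this
  simp only [Polynomial.eval_pow, Polynomial.eval_X, one_pow, Finset.sum_const, nsmul_eq_mul,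
    mul_one, Finset.card_univ] at this
  exact h (by exact_mod_cast this)

/-- The Kloosterman sum of an additive character of a finite commutative ring. -/
noncomputable def kloostermanChar {R : Type*} [CommRing R] [Fintype Rˣ] (ψ : AddChar R ℂ)
    (a b : R) : ℂ :=
  ∑ u : Rˣ, ψ (a * u + b * ↑u⁻¹)

theorem kloostermanChar_ringEquiv {R S : Type*} [CommRing R] [CommRing S] [Fintype Rˣ]
    [Fintype Sˣ] (e : S ≃+* R) (ψ : AddChar R ℂ) (a b : R) :
    kloostermanChar ψ a b =
      kloostermanChar (ψ.compAddMonoidHom e.toAddMonoidHom) (e.symm a) (e.symm b) := by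
  unfold kloostermanChar
  refine (Fintype.sum_equiv (Units.mapEquiv e.toMulEquiv).toEquiv _ _ fun u => ?_).symm
  simp [AddChar.compAddMonoidHom_apply, ← map_inv]

theorem kloostermanChar_prod {R S : Type*} [CommRing R] [CommRing S] [Fintype Rˣ]
    [Fintype Sˣ] [Fintype (R × S)ˣ] (ψ : AddChar (R × S) ℂ) (a b : R × S) :
    kloostermanChar ψ a b =
      kloostermanChar (ψ.compAddMonoidHom (AddMonoidHom.inl R S)) a.1 b.1 *
      kloostermanChar (ψ.compAddMonoidHom (AddMonoidHom.inr R S)) a.2 b.2 := by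
  unfold kloostermanChar
  rw [Fintype.sum_mul_sum, ← Fintype.sum_prod_type']
  refine Fintype.sum_equiv MulEquiv.prodUnits.toEquiv _ _ fun u => ?_
  rw [AddChar.compAddMonoidHom_apply, AddChar.compAddMonoidHom_apply, ← AddChar.map_add_eq_mul]
  congr 1
  ext <;> simp [MulEquiv.prodUnits, ← map_inv]

/-- All characters `ψ` are allowed because splitting the modulus does not preserve the standard one.
-/
theorem kloostermanChar_ne_zero (n : ℕ) (hn : Squarefree n) :
    ∀ [NeZero n] (ψ : AddChar (ZMod n) ℂ) (a b : ZMod n), kloostermanChar ψ a b ≠ 0 := by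
  induction n using Nat.recOnPosPrimePosCoprime with
  | zero => exact absurd hn not_squarefree_zero
  | one =>
    intro _ ψ a b
    have hs : ∀ x : ZMod 1, x = 0 := fun x => Subsingleton.elim _ _
    simp only [kloostermanChar, hs (_ + _), AddChar.map_zero_eq_one]
    simp
  | prime_pow p k hp hk =>
    obtain rfl : k = 1 :=
      (hn.eq_zero_or_one_of_pow_of_not_isUnit hp.not_isUnit).resolve_left hk.ne'
    rw [pow_one]
    intro _ ψ a b
    have : Fact p.Prime := ⟨hp⟩
    apply sum_addChar_ne_zero_of_prime
    rw [ZMod.card_units_eq_totient, Nat.totient_prime hp]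
    exact Nat.not_dvd_of_pos_of_lt (Nat.sub_pos_of_lt hp.one_lt) (Nat.sub_lt hp.pos one_pos)
  | coprime m k hm hk hmk ihm ihk =>
    have : NeZero m := ⟨by omega⟩
    have : NeZero k := ⟨by omega⟩
    obtain ⟨-, h1, h2⟩ := Nat.squarefree_mul_iff.1 hn
    classical
    have : Fintype (ZMod m × ZMod k)ˣ := Fintype.ofFinite _
    intro _ ψ a b
    rw [kloostermanChar_ringEquiv (ZMod.chineseRemainder hmk).symm, kloostermanChar_prod]
    exact mul_ne_zero (ihm h1 _ _ _) (ihk h2 _ _ _)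

/-! ### Second moment -/

theorem sum_fiber_stdAddChar {c : ℕ} [NeZero c] (u v : (ZMod c)ˣ) :
    ∑ t : ZMod c, ZMod.stdAddChar (t * ((↑u⁻¹ : ZMod c) - ((v⁻¹ : (ZMod c)ˣ) : ZMod c))) = if u = v then (c : ℂ) else 0 := by
  rw [AddChar.sum_mulShift _ (ZMod.isPrimitive_stdAddChar c), ZMod.card]
  simp only [sub_eq_zero, Units.val_inj, inv_inj]
  split_ifs <;> simp

theorem sum_sq_norm_kloostermanChar (c : ℕ) [NeZero c] :
    ∑ t : ZMod c, ‖kloostermanChar ZMod.stdAddChar 1 t‖ ^ 2 = c * c.totient := by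
  have key : ∀ t : ZMod c, ((‖kloostermanChar ZMod.stdAddChar 1 t‖ ^ 2 : ℝ) : ℂ) =
      ∑ u : (ZMod c)ˣ, ∑ v : (ZMod c)ˣ, ZMod.stdAddChar ((u : ZMod c) - (v : ZMod c)) *
        ZMod.stdAddChar (t * ((↑u⁻¹ : ZMod c) - ((v⁻¹ : (ZMod c)ˣ) : ZMod c))) := by
    intro t
    push_cast
    rw [← Complex.mul_conj', kloostermanChar, map_sum, Fintype.sum_mul_sum]
    refine Finset.sum_congr rfl fun u _ => Finset.sum_congr rfl fun v _ => ?_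
    rw [← AddChar.map_neg_eq_conj, ← AddChar.map_add_eq_mul, ← AddChar.map_add_eq_mul]
    congr 1
    ring
  apply Complex.ofReal_injective
  rw [Complex.ofReal_sum, Finset.sum_congr rfl fun t _ => key t, Finset.sum_comm]
  simp_rw [fun u : (ZMod c)ˣ => Finset.sum_comm (s := (Finset.univ : Finset (ZMod c)))
    (t := (Finset.univ : Finset (ZMod c)ˣ))
    (f := fun t v => ZMod.stdAddChar ((u : ZMod c) - (v : ZMod c)) *
        (ZMod.stdAddChar (t * ((↑u⁻¹ : ZMod c) - ((v⁻¹ : (ZMod c)ˣ) : ZMod c))) : ℂ)), ← Finset.mul_sum,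
    sum_fiber_stdAddChar]
  simp [ZMod.card_units_eq_totient, mul_comm]

/-! ### Galois conjugates and the norm -/

theorem one_le_prod_norm_conjugates {c : ℕ} [NeZero c] {ι : Type*} [Fintype ι]
    (f : ι → ZMod c) (h : ∑ i, (ZMod.stdAddChar (f i) : ℂ) ≠ 0) :
    1 ≤ ∏ k : (ZMod c)ˣ, ‖∑ i, (ZMod.stdAddChar ((k : ZMod c) * f i) : ℂ)‖ := by
  have hcyc : IsCyclotomicExtension {c} ℚ (CyclotomicField c ℚ) :=
    CyclotomicField.isCyclotomicExtension c ℚ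
  have hζ : IsPrimitiveRoot (IsCyclotomicExtension.zeta c ℚ (CyclotomicField c ℚ)) c :=
    IsCyclotomicExtension.zeta_spec c ℚ (CyclotomicField c ℚ)
  have hirr : Irreducible (Polynomial.cyclotomic c ℚ) :=
    Polynomial.cyclotomic.irreducible_rat (NeZero.pos c)
  set ζ := IsCyclotomicExtension.zeta c ℚ (CyclotomicField c ℚ) with hζdef
  have hw : IsPrimitiveRoot (ZMod.stdAddChar (1 : ZMod c) : ℂ) c := by
    have := ZMod.stdAddChar_coe (N := c) 1
    rw [Int.cast_one] at this
    rw [this]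
    simpa using Complex.isPrimitiveRoot_exp c (NeZero.ne c)
  -- This embedding carries the Galois action `ζ ↦ ζ ^ k` to multiplication by `k` inside
  -- `ZMod.stdAddChar`.
  obtain ⟨φ, hφ⟩ : ∃ φ : CyclotomicField c ℚ →ₐ[ℚ] ℂ, φ ζ = ZMod.stdAddChar (1 : ZMod c) := by
    refine ⟨(hζ.embeddingsEquivPrimitiveRoots ℂ hirr).symm
      ⟨_, (mem_primitiveRoots (NeZero.pos c)).2 hw⟩, ?_⟩
    rw [← IsPrimitiveRoot.embeddingsEquivPrimitiveRoots_apply_coe hζ ℂ hirr]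
    simp
  have hφ' : ∀ x : ZMod c, φ (ζ ^ x.val) = ZMod.stdAddChar x := fun x => by
    rw [map_pow, hφ, ← AddChar.zmod_eq_pow_val]
  set α : CyclotomicField c ℚ := ∑ i, ζ ^ (f i).val with hα
  have hα0 : α ≠ 0 := by
    intro h0
    apply h
    rw [← map_zero φ, ← h0, hα, map_sum]
    exact Finset.sum_congr rfl fun i _ => (hφ' _).symm
  have hint : IsIntegral ℤ α :=
    IsIntegral.sum _ fun i _ => (hζ.isIntegral (NeZero.pos c)).pow _
  have : IsGalois ℚ (CyclotomicField c ℚ) := IsCyclotomicExtension.isGalois {c} ℚ (CyclotomicField c ℚ)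
  obtain ⟨z, hz⟩ := IsIntegrallyClosed.isIntegral_iff.1 (Algebra.isIntegral_norm ℚ hint)
  have hz0 : z ≠ 0 := by
    rintro rfl
    exact hα0 (Algebra.norm_eq_zero_iff.1 (by rw [← hz, map_zero]))
  have hprod : ∏ k : (ZMod c)ˣ, ∑ i, (ZMod.stdAddChar ((k : ZMod c) * f i) : ℂ) = (z : ℂ) := by
    have h1 := congrArg φ (Algebra.norm_eq_prod_automorphisms ℚ α)
    rw [← hz, map_prod] at h1
    have h2 : φ (algebraMap ℚ (CyclotomicField c ℚ) (algebraMap ℤ ℚ z)) = z := by simp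
    rw [← h2, h1]
    refine (Fintype.prod_equiv (IsCyclotomicExtension.autEquivPow (CyclotomicField c ℚ) hirr).toEquiv _ _
      fun σ => ?_).symm
    rw [hα, map_sum, map_sum]
    refine Finset.sum_congr rfl fun i _ => ?_
    have hσ : σ ζ = ζ ^ ((IsCyclotomicExtension.autEquivPow (CyclotomicField c ℚ) hirr σ : (ZMod c)ˣ) : ZMod c).val :=
      (hζ.autToPow_spec ℚ σ).symm
    rw [map_pow, hσ, ← hφ', ZMod.val_mul, ← pow_mul]
    congr 1
    exact pow_eq_pow_mod _ hζ.pow_eq_one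
  rw [← norm_prod, hprod, Complex.norm_intCast]
  exact_mod_cast Int.one_le_abs hz0

/-- Each odd prime factor contributes the two roots `±1`, combined by the Chinese remainder theorem.
-/
theorem card_divisors_le_card_sq_eq_one (n : ℕ) (hn : Squarefree n) (ho : Odd n) :
    ∀ [NeZero n], n.divisors.card ≤ Fintype.card {u : (ZMod n)ˣ // u ^ 2 = 1} := by
  induction n using Nat.recOnPosPrimePosCoprime with
  | zero => exact absurd hn not_squarefree_zero
  | one =>
    intro _
    simp only [Nat.divisors_one, Finset.card_singleton]
    exact Fintype.card_pos_iff.2 ⟨⟨1, one_pow 2⟩⟩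
  | prime_pow p k hp hk =>
    obtain rfl : k = 1 :=
      (hn.eq_zero_or_one_of_pow_of_not_isUnit hp.not_isUnit).resolve_left hk.ne'
    intro _
    rw [Nat.divisors_prime_pow hp, Finset.card_map, Finset.card_range, Nat.succ_le_iff,
      Fintype.one_lt_card_iff]
    refine ⟨⟨1, one_pow 2⟩, ⟨-1, by simp⟩, ?_⟩
    rw [Ne, Subtype.mk.injEq, Units.ext_iff]
    have : Fact (2 < p ^ 1) := ⟨by
      rw [pow_one] at ho ⊢
      exact lt_of_le_of_ne hp.two_le fun h => absurd ho (by rw [← h]; decide)⟩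
    simpa using (ZMod.neg_one_ne_one (n := p ^ 1)).symm
  | coprime m k hm hk hmk ihm ihk =>
    have : NeZero m := ⟨by omega⟩
    have : NeZero k := ⟨by omega⟩
    obtain ⟨-, h1, h2⟩ := Nat.squarefree_mul_iff.1 hn
    obtain ⟨o1, o2⟩ := Nat.odd_mul.1 ho
    intro _
    rw [hmk.card_divisors_mul]
    refine (Nat.mul_le_mul (ihm h1 o1) (ihk h2 o2)).trans ?_
    rw [← Fintype.card_prod]
    let e : (ZMod (m * k))ˣ ≃* (ZMod m)ˣ × (ZMod k)ˣ :=
      (Units.mapEquiv (ZMod.chineseRemainder hmk).toMulEquiv).trans MulEquiv.prodUnits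
    refine Fintype.card_le_of_injective
      (fun x => ⟨e.symm (x.1.1, x.2.1), by
        rw [← map_pow, Prod.pow_mk, x.1.2, x.2.2, Prod.mk_one_one, map_one]⟩) ?_
    intro x y hxy
    have := e.symm.injective (Subtype.mk.inj hxy)
    rw [Prod.mk.injEq] at this
    exact Prod.ext (Subtype.ext this.1) (Subtype.ext this.2)

/-- AM-GM after padding the family with `M - t.card` ones, a possibly fractional number, so that the
exponent is `M` rather than `t.card`. -/
theorem prod_le_rpow_of_sum_le {ι : Type*} (t : Finset ι) (z : ι → ℝ) (hz : ∀ i ∈ t, 0 ≤ z i)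
    {B M : ℝ} (hB : 0 < B) (hM : (t.card : ℝ) ≤ M)
    (h : ∑ i ∈ t, z i + (M - t.card) ≤ B * M) : ∏ i ∈ t, z i ≤ B ^ M := by
  have hle : ∀ x, x ≤ B * Real.exp (x / B - 1) := fun x => by
    have := mul_le_mul_of_nonneg_left (Real.add_one_le_exp (x / B - 1)) hB.le
    rwa [sub_add_cancel, mul_div_cancel₀ _ hB.ne'] at this
  have h1 : ∏ i ∈ t, z i ≤ B ^ t.card * Real.exp (∑ i ∈ t, z i / B - t.card) := by
    refine (Finset.prod_le_prod hz fun i _ => hle (z i)).trans_eq ?_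
    rw [Finset.prod_mul_distrib, Finset.prod_const, ← Real.exp_sum, Finset.sum_sub_distrib]
    simp
  have hlog : 1 - 1 / B ≤ Real.log B := by
    simpa using Real.one_sub_inv_le_log_of_pos hB
  refine h1.trans ?_
  rw [Real.rpow_def_of_pos hB, ← Real.rpow_natCast, Real.rpow_def_of_pos hB, ← Real.exp_add,
    Real.exp_le_exp, ← Finset.sum_div]
  have h2 := mul_le_mul_of_nonneg_right hlog (sub_nonneg.2 hM)
  have h3 : (∑ i ∈ t, z i + (M - t.card)) / B ≤ M := by
    rw [div_le_iff₀ hB]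
    linarith
  rw [add_div] at h3
  have h4 : (M - (t.card : ℝ)) / B = 1 / B * (M - t.card) := by ring
  nlinarith

theorem kloostermanSum_eq_kloostermanChar (a b : ℤ) (c : ℕ) [NeZero c] :
    kloostermanSum a b c = kloostermanChar (R := ZMod c) ZMod.stdAddChar a b := by
  unfold kloostermanSum kloostermanChar
  symm
  refine Finset.sum_bij (fun u _ => (u : ZMod c).val) (fun u _ => ?_) (fun u _ v _ h => ?_)
    (fun x hx => ?_) (fun u _ => ?_)
  · simpa using ⟨ZMod.val_lt _, ZMod.val_coe_unit_coprime u⟩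
  · exact Units.ext (ZMod.val_injective c h)
  · rw [Finset.mem_filter, Finset.mem_range] at hx
    exact ⟨ZMod.unitOfCoprime x hx.2, Finset.mem_univ _, by
      rw [ZMod.coe_unitOfCoprime, ZMod.val_cast_of_lt hx.1]⟩
  · have h : (a : ZMod c) * u + b * (u⁻¹ : (ZMod c)ˣ) =
        ((a * (u : ZMod c).val + b * ((((u : ZMod c).val : ℕ) : ZMod c)⁻¹).val : ℤ) : ZMod c) := by
      push_cast
      simp
    rw [h, ZMod.stdAddChar_coe]
    congr 1
    push_cast
    ring

/-! ### Square orbits and the lower bound -/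

theorem kloostermanChar_units_mul {R : Type*} [CommRing R] [Fintype Rˣ] (ψ : AddChar R ℂ)
    (s : Rˣ) (a b : R) : kloostermanChar ψ (s * a) b = kloostermanChar ψ a (s * b) := by
  refine Fintype.sum_equiv (Equiv.mulLeft s) _ _ fun u => ?_
  congr 1
  have : (s : R) * (s⁻¹ : Rˣ) = 1 := s.mul_inv
  simp only [Equiv.coe_mulLeft, mul_inv, Units.val_mul]
  linear_combination (-(b * (u⁻¹ : Rˣ))) * this

theorem one_le_prod_norm_kloostermanChar {c : ℕ} [NeZero c] (hc : Squarefree c) (m : ZMod c) :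
    1 ≤ ∏ k : (ZMod c)ˣ, ‖kloostermanChar ZMod.stdAddChar 1 ((k : ZMod c) ^ 2 * m)‖ := by
  have h := one_le_prod_norm_conjugates (fun u : (ZMod c)ˣ => (u : ZMod c) + m * ((u⁻¹ : (ZMod c)ˣ) : ZMod c))
    (by simpa [kloostermanChar] using kloostermanChar_ne_zero c hc ZMod.stdAddChar 1 m)
  refine h.trans_eq (Finset.prod_congr rfl fun k _ => ?_)
  rw [pow_two, mul_assoc, ← kloostermanChar_units_mul, kloostermanChar]
  congr 1
  refine Finset.sum_congr rfl fun u _ => ?_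
  congr 1
  ring

theorem card_fiber_sq_mul {c : ℕ} [NeZero c] (m : ZMod c) (k₀ : (ZMod c)ˣ) :
    (Finset.univ.filter fun k : (ZMod c)ˣ => (k : ZMod c) ^ 2 * m = (k₀ : ZMod c) ^ 2 * m).card =
      (Finset.univ.filter fun k : (ZMod c)ˣ => (k : ZMod c) ^ 2 * m = m).card := by
  refine (Finset.card_equiv (Equiv.mulLeft k₀) fun k => ?_).symm
  simp only [Finset.mem_filter, Finset.mem_univ, true_and, Equiv.coe_mulLeft, Units.val_mul,
    mul_pow, mul_assoc]
  rw [← Units.val_pow_eq_pow_val k₀, Units.mul_right_inj]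

/-- The orbit of `m` under multiplication by squares of units modulo `c`. -/
def squareOrbit {c : ℕ} [NeZero c] (m : ZMod c) : Finset (ZMod c) :=
  Finset.univ.image fun k : (ZMod c)ˣ => (k : ZMod c) ^ 2 * m

theorem mem_squareOrbit_self {c : ℕ} [NeZero c] (m : ZMod c) : m ∈ squareOrbit m :=
  Finset.mem_image.2 ⟨1, Finset.mem_univ _, by simp⟩

theorem card_squareOrbit_mul {c : ℕ} [NeZero c] (m : ZMod c) :
    (squareOrbit m).card * (Finset.univ.filter fun k : (ZMod c)ˣ => (k : ZMod c) ^ 2 * m = m).card =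
      c.totient := by
  rw [← ZMod.card_units_eq_totient, ← Finset.card_univ,
    Finset.card_eq_sum_card_image (fun k : (ZMod c)ˣ => (k : ZMod c) ^ 2 * m) Finset.univ,
    ← smul_eq_mul, ← Finset.sum_const]
  refine Finset.sum_congr rfl fun t ht => ?_
  obtain ⟨k₀, -, rfl⟩ := Finset.mem_image.1 ht
  exact (card_fiber_sq_mul m k₀).symm

theorem card_squareOrbit_mul_card_divisors_le {c : ℕ} [NeZero c] (hc : Squarefree c) (ho : Odd c)
    (m : ZMod c) : (squareOrbit m).card * c.divisors.card ≤ c.totient := by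
  rw [← card_squareOrbit_mul m]
  refine Nat.mul_le_mul_left _ ((card_divisors_le_card_sq_eq_one c hc ho).trans ?_)
  rw [Fintype.card_subtype]
  refine Finset.card_le_card (Finset.monotone_filter_right _ fun k _ hk => ?_)
  rw [← Units.val_pow_eq_pow_val, hk, Units.val_one, one_mul]

theorem one_le_prod_squareOrbit {c : ℕ} [NeZero c] (hc : Squarefree c) (m : ZMod c) :
    1 ≤ ∏ t ∈ squareOrbit m, ‖kloostermanChar ZMod.stdAddChar 1 t‖ := by
  have h := one_le_prod_norm_kloostermanChar hc m
  rw [Finset.prod_comp (fun t : ZMod c => ‖kloostermanChar ZMod.stdAddChar 1 t‖)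
    (fun k : (ZMod c)ˣ => (k : ZMod c) ^ 2 * m)] at h
  have h2 : ∏ t ∈ squareOrbit m, ‖kloostermanChar ZMod.stdAddChar 1 t‖ ^
      (Finset.univ.filter fun k : (ZMod c)ˣ => (k : ZMod c) ^ 2 * m = t).card =
      (∏ t ∈ squareOrbit m, ‖kloostermanChar ZMod.stdAddChar 1 t‖) ^
      (Finset.univ.filter fun k : (ZMod c)ˣ => (k : ZMod c) ^ 2 * m = m).card := by
    rw [← Finset.prod_pow]
    refine Finset.prod_congr rfl fun t ht => ?_
    obtain ⟨k₀, -, rfl⟩ := Finset.mem_image.1 ht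
    rw [card_fiber_sq_mul]
  rw [squareOrbit] at h2 ⊢
  rw [h2] at h
  by_contra hlt
  refine absurd h (not_le.2 (pow_lt_one₀ (Finset.prod_nonneg fun _ _ => norm_nonneg _)
    (not_le.1 hlt) (Finset.card_ne_zero.2 ⟨1, by simp⟩)))

theorem prod_sq_norm_erase_squareOrbit_le {c : ℕ} [NeZero c] (hc : Squarefree c) (ho : Odd c)
    (m : ZMod c) :
    ∏ t ∈ (squareOrbit m).erase m, ‖kloostermanChar ZMod.stdAddChar 1 t‖ ^ 2 ≤
      ((c.divisors.card : ℝ) ^ 2 * c) ^ ((c.totient : ℝ) / c.divisors.card - 1) := by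
  have hcpos : 0 < c := NeZero.pos c
  have hτ1 : 1 ≤ c.divisors.card := Finset.card_pos.2 ⟨1, by simp [hcpos.ne']⟩
  have hτ1' : (1 : ℝ) ≤ c.divisors.card := by exact_mod_cast hτ1
  have hc1 : (1 : ℝ) ≤ c := by exact_mod_cast hcpos
  have hB : (1 : ℝ) ≤ (c.divisors.card : ℝ) ^ 2 * c :=
    one_le_mul_of_one_le_of_one_le (one_le_pow₀ hτ1') hc1
  have hcard : ((squareOrbit m).card : ℝ) ≤ (c.totient : ℝ) / c.divisors.card := by
    rw [le_div_iff₀ (by linarith)]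
    exact_mod_cast card_squareOrbit_mul_card_divisors_le hc ho m
  have hpos : 1 ≤ (squareOrbit m).card := Finset.card_pos.2 ⟨m, mem_squareOrbit_self m⟩
  rcases hpos.eq_or_lt with h1 | h1
  -- A one-point orbit is treated apart: the estimate below needs at least two points.
  · have : (squareOrbit m).erase m = ∅ := by
      rw [← Finset.card_eq_zero, Finset.card_erase_of_mem (mem_squareOrbit_self m), ← h1]
    rw [this, Finset.prod_empty]
    refine Real.one_le_rpow hB ?_
    rw [← h1] at hcard
    simpa using hcard
  have hcne : c ≠ 1 := by
    rintro rfl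
    have := card_squareOrbit_mul_card_divisors_le hc ho m
    simp at this
    omega
  have hτ2 : (2 : ℝ) ≤ c.divisors.card := by
    have : 1 < c.divisors.card := Finset.one_lt_card.2
      ⟨1, by simp [hcpos.ne'], c, by simp [hcpos.ne'], hcne.symm⟩
    exact_mod_cast this
  have herase : (((squareOrbit m).erase m).card : ℝ) = (squareOrbit m).card - 1 := by
    rw [Finset.card_erase_of_mem (mem_squareOrbit_self m), Nat.cast_sub hpos, Nat.cast_one]
  refine prod_le_rpow_of_sum_le _ _ (fun _ _ => sq_nonneg _) (by linarith) (by linarith) ?_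
  have hsum : ∑ t ∈ (squareOrbit m).erase m, ‖kloostermanChar ZMod.stdAddChar 1 t‖ ^ 2 ≤
      c * c.totient := by
    rw [← sum_sq_norm_kloostermanChar]
    exact Finset.sum_le_univ_sum_of_nonneg fun _ => sq_nonneg _
  have h2 : (2 : ℝ) ≤ (squareOrbit m).card := by exact_mod_cast h1
  obtain ⟨n, hn⟩ : ∃ n, n = (c.totient : ℝ) / c.divisors.card := ⟨_, rfl⟩
  have hφ : (c.totient : ℝ) = n * c.divisors.card := by
    rw [hn, div_mul_cancel₀ _ (by linarith)]
  rw [hφ] at hsum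
  rw [← hn] at hcard ⊢
  rw [herase]
  generalize (c.divisors.card : ℝ) = τ at *
  generalize (c : ℝ) = C at *
  -- With `N ≥ 2` orbit points, the padding `n - N` is at most `Cτ(n - 2)`. Added to the second
  -- moment `Cτn` this gives `2Cτ(n - 1)`, and `τ ≥ 2` absorbs the factor 2.
  have hn2 : 0 ≤ n - 2 := by linarith
  have h3 : n - 2 ≤ C * τ * (n - 2) :=
    le_mul_of_one_le_left hn2 (one_le_mul_of_one_le_of_one_le hc1 hτ1')
  have h4 : C * τ * (2 * (n - 1)) ≤ C * τ * (τ * (n - 1)) := by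
    gcongr
    linarith
  nlinarith

theorem one_div_rpow_le_norm_kloostermanChar {c : ℕ} [NeZero c] (hc : Squarefree c) (ho : Odd c)
    (m : ZMod c) :
    1 / ((c.divisors.card : ℝ) * Real.sqrt c) ^ ((c.totient : ℝ) / c.divisors.card - 1) ≤
      ‖kloostermanChar ZMod.stdAddChar 1 m‖ := by
  have hτ : (0 : ℝ) < c.divisors.card := by
    exact_mod_cast Finset.card_pos.2 ⟨1, by simp [NeZero.ne c]⟩
  have hb : (0 : ℝ) < (c.divisors.card : ℝ) * Real.sqrt c :=
    mul_pos hτ (Real.sqrt_pos.2 (by exact_mod_cast NeZero.pos c))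
  rw [div_le_iff₀ (Real.rpow_pos_of_pos hb _)]
  have h := one_le_prod_squareOrbit hc m
  rw [← Finset.mul_prod_erase _ _ (mem_squareOrbit_self m)] at h
  refine h.trans (mul_le_mul_of_nonneg_left ?_ (norm_nonneg _))
  refine le_of_sq_le_sq ?_ (Real.rpow_pos_of_pos hb _).le
  rw [← Finset.prod_pow, ← Real.rpow_natCast, ← Real.rpow_mul hb.le, mul_comm _ ((2 : ℕ) : ℝ),
    Real.rpow_mul hb.le, Real.rpow_natCast, mul_pow, Real.sq_sqrt (Nat.cast_nonneg c)]
  exact prod_sq_norm_erase_squareOrbit_le hc ho m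

theorem proposition2p1 (a b : ℤ) (c : ℕ) (hc : Squarefree c) (hac : Int.gcd a (c : ℤ) = 1) :
    kloostermanSum a b c ≠ 0 ∧
      (Odd c →
        1 / (((c.divisors.card : ℕ) : ℝ) * Real.sqrt (c : ℝ)) ^
            (((Nat.totient c : ℕ) : ℝ) / ((c.divisors.card : ℕ) : ℝ) - 1)
          ≤ ‖kloostermanSum a b c‖) := by
  have : NeZero c := ⟨hc.ne_zero⟩
  rw [kloostermanSum_eq_kloostermanChar]
  refine ⟨kloostermanChar_ne_zero c hc _ _ _, fun ho => ?_⟩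
  obtain ⟨s, hs⟩ := (ZMod.coe_int_isUnit_iff_isCoprime a c).2
    (Int.isCoprime_iff_gcd_eq_one.2 (by rwa [Int.gcd_comm]))
  rw [← hs, ← mul_one (s : ZMod c), kloostermanChar_units_mul]
  exact one_div_rpow_le_norm_kloostermanChar hc ho _
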